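/- Let $G=\{(a,b): a>0,\ b\in\mathbb{R}\}$ be the $ax+b$ group, with product $(a,b)(c,d)=(ac,ad+b)$ and inverse $(a,b)^{-1}=(1/a,-b/a)$, equipped with the discrete topology, and let $H_b=\{(1,b): b\in\mathbb{R}\}$. Let $\omega:G\to(0,\infty)$ be a weight, i.e. $\omega(xy)\le\omega(x)\omega(y)$ for all $x,y\in G$. Let $\ell^1(G,\omega)$ be the Banach algebra of all $f:G\to\mathbb{C}$ with $\|f\|_\omega=\sum_{x\in G}|f(x)|\,\omega(x)<\infty$, with the convolution product $(f*g)(y)=\sum_{x\in G}f(x)g(x^{-1}y)$. A Banach algebra $A$ is called weakly amenable if every continuous derivation $D:A\to A^*$ (a continuous linear map with $D(xy)=x\cdot D(y)+D(x)\cdot y$ for all $x,y\in A$) is inner, i.e. of the form $D(x)=x\cdot f-f\cdot x$ for some $f\in A^*$, where $\langle y,x\cdot f\rangle=\langle yx,f\rangle$ and $\langle y,f\cdot x\rangle=\langle xy,f\rangle$. Suppose that $\omega$ is bounded away from zero on $G$ (there is $c>0$ with $\omega(x)\ge c$ for all $x\in G$) and that $\omega$ is bounded on $H_b$. Then $\ell^1(G,\omega)$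 is weakly amenable if and only if $\omega$ is diagonally bounded, i.e. the function $x\mapsto\omega(x)\omega(x^{-1})$ is bounded on $G$. -/

import Mathlib

open scoped ENNReal

noncomputable section

/-! ## Weak amenability of Banach algebras -/

section WeakAmenability

variable {A : Type*} [NonUnitalNormedRing A] [NormedSpace ℂ A] [IsScalarTower ℂ A A]
  [SMulCommClass ℂ A A]

/-- Left action of `A` on its dual: `⟨x, a · f⟩ = ⟨x a, f⟩`. -/
def dualLeftAction (a : A) (f : StrongDual ℂ A) : StrongDual ℂ A :=
  f.comp ((ContinuousLinearMap.mul ℂ A).flip a)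

/-- Right action of `A` on its dual: `⟨x, f · a⟩ = ⟨a x, f⟩`. -/
def dualRightAction (f : StrongDual ℂ A) (a : A) : StrongDual ℂ A :=
  f.comp (ContinuousLinearMap.mul ℂ A a)

/-- `D : A → A*` is a derivation: `D (ab) = a · D b + D a · b`. -/
def IsDualDerivation (D : A →L[ℂ] StrongDual ℂ A) : Prop :=
  ∀ a b : A, D (a * b) = dualLeftAction a (D b) + dualRightAction (D a) b

/-- `D : A → A*` is inner: `D a = a · f - f · a` for some `f ∈ A*`. -/
def IsInnerDualDerivation (D : A →L[ℂ] StrongDual ℂ A) : Prop :=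
  ∃ f : StrongDual ℂ A, ∀ a : A, D a = dualLeftAction a f - dualRightAction f a

variable (A) in
/-- A complex Banach algebra is weakly amenable if every continuous derivation into its dual
is inner. -/
def WeaklyAmenable [CompleteSpace A] : Prop :=
  ∀ D : A →L[ℂ] StrongDual ℂ A, IsDualDerivation D → IsInnerDualDerivation D

end WeakAmenability

/-! ## Weights on discrete groups -/

/-- A weight on a discrete group: a positive submultiplicative function. (Local boundedness,
measurability and continuity are automatic for the discrete topology.) -/
structure Weight (G : Type*) [Group G] where
  toFun : G → ℝ
  pos' : ∀ x, 0 < toFun x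
  submul' : ∀ x y, toFun (x * y) ≤ toFun x * toFun y

namespace Weight

variable {G : Type*} [Group G]

instance : CoeFun (Weight G) (fun _ => G → ℝ) := ⟨Weight.toFun⟩

theorem pos (ω : Weight G) (x : G) : 0 < ω x := ω.pos' x

theorem submul (ω : Weight G) (x y : G) : ω (x * y) ≤ ω x * ω y := ω.submul' x y

def BoundedAwayFromZero (ω : Weight G) : Prop := ∃ c : ℝ, 0 < c ∧ ∀ x, c ≤ ω x

def BoundedOn (ω : Weight G) (S : Set G) : Prop := ∃ C : ℝ, ∀ x ∈ S, ω x ≤ C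

def DiagonallyBounded (ω : Weight G) : Prop := ∃ C : ℝ, ∀ x, ω x * ω x⁻¹ ≤ C

end Weight

/-! ## The discrete Beurling algebra `ℓ¹(G, ω)` -/

/-- The functions `f : G → ℂ` with `∑ |f x| ω x < ∞`. -/
def beurlingSubmodule {G : Type*} [Group G] (ω : Weight G) : Submodule ℂ (G → ℂ) where
  carrier := {f | Summable fun x => ‖f x‖ * ω x}
  zero_mem' := by simp [summable_zero]
  add_mem' := by
    intro f g hf hg
    refine Summable.of_nonneg_of_le (fun x => mul_nonneg (norm_nonneg _) (ω.pos x).le)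
      (fun x => ?_) (Summable.add hf hg)
    rw [← add_mul]
    exact mul_le_mul_of_nonneg_right (norm_add_le _ _) (ω.pos x).le
  smul_mem' := by
    intro c f hf
    have := Summable.mul_left ‖c‖ hf
    simpa [mul_assoc] using this

/-- The underlying space of `ℓ¹(G, ω)`. It carries the norm `∑ |f x| ω x` and the convolution
product, defined below. -/
def BeurlingAlgebra {G : Type*} [Group G] (ω : Weight G) : Type _ := beurlingSubmodule ω

namespace BeurlingAlgebra

variable {G : Type*} [Group G] {ω : Weight G}

instance : AddCommGroup (BeurlingAlgebra ω) := inferInstanceAs (AddCommGroup (beurlingSubmodule ω))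

instance : Module ℂ (BeurlingAlgebra ω) := inferInstanceAs (Module ℂ (beurlingSubmodule ω))

instance : FunLike (BeurlingAlgebra ω) G ℂ where
  coe f := Subtype.val (p := (· ∈ beurlingSubmodule ω)) f
  coe_injective := Subtype.val_injective

def mk (f : G → ℂ) (hf : Summable fun x => ‖f x‖ * ω x) : BeurlingAlgebra ω := ⟨f, hf⟩

@[simp] theorem mk_apply (f : G → ℂ) (hf : Summable fun x => ‖f x‖ * ω x) (x : G) :
    (mk f hf : BeurlingAlgebra ω) x = f x := rfl

@[ext] theorem ext {f g : BeurlingAlgebra ω} (h : ∀ x, f x = g x) : f = g :=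
  DFunLike.ext f g h

theorem summable (f : BeurlingAlgebra ω) : Summable fun x => ‖f x‖ * ω x := f.2

@[simp] theorem zero_apply (x : G) : (0 : BeurlingAlgebra ω) x = 0 := rfl
@[simp] theorem add_apply (f g : BeurlingAlgebra ω) (x : G) : (f + g) x = f x + g x := rfl
@[simp] theorem neg_apply (f : BeurlingAlgebra ω) (x : G) : (-f) x = -f x := rfl
@[simp] theorem sub_apply (f g : BeurlingAlgebra ω) (x : G) : (f - g) x = f x - g x := rfl
@[simp] theorem smul_apply (c : ℂ) (f : BeurlingAlgebra ω) (x : G) : (c • f) x = c * f x := rfl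

instance : Norm (BeurlingAlgebra ω) := ⟨fun f => ∑' x, ‖f x‖ * ω x⟩

theorem norm_def (f : BeurlingAlgebra ω) : ‖f‖ = ∑' x, ‖f x‖ * ω x := rfl

theorem term_nonneg (f : BeurlingAlgebra ω) (x : G) : 0 ≤ ‖f x‖ * ω x :=
  mul_nonneg (norm_nonneg _) (ω.pos x).le

theorem term_le_norm (f : BeurlingAlgebra ω) (x : G) : ‖f x‖ * ω x ≤ ‖f‖ :=
  f.summable.le_tsum x (fun y _ => term_nonneg f y)

theorem normedSpaceCore : NormedSpace.Core ℂ (BeurlingAlgebra ω) where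
  norm_nonneg f := tsum_nonneg (term_nonneg f)
  norm_smul c f := by
    simp only [norm_def, smul_apply, norm_mul, mul_assoc]
    exact tsum_mul_left
  norm_triangle f g := by
    simp only [norm_def]
    rw [← f.summable.tsum_add g.summable]
    refine (f + g).summable.tsum_le_tsum (fun x => ?_) (f.summable.add g.summable)
    rw [← add_mul]
    exact mul_le_mul_of_nonneg_right (norm_add_le _ _) (ω.pos x).le
  norm_eq_zero_iff f := by
    constructor
    · intro h
      ext x
      have h1 := term_le_norm f x
      rw [h] at h1
      have h2 : ‖f x‖ * ω x = 0 := le_antisymm h1 (term_nonneg f x)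
      simpa [(ω.pos x).ne'] using h2
    · rintro rfl
      simp [norm_def]

instance : NormedAddCommGroup (BeurlingAlgebra ω) := NormedAddCommGroup.ofCore normedSpaceCore

instance : NormedSpace ℂ (BeurlingAlgebra ω) := NormedSpace.ofCore normedSpaceCore

/-- `(x, y) ↦ (x, x y)`. -/
def shear (G : Type*) [Group G] : G × G ≃ G × G where
  toFun p := (p.1, p.1 * p.2)
  invFun p := (p.1, p.1⁻¹ * p.2)
  left_inv p := by simp
  right_inv p := by simp

theorem summable_prod (f g : BeurlingAlgebra ω) :
    Summable fun p : G × G => (‖f p.1‖ * ω p.1) * (‖g (p.1⁻¹ * p.2)‖ * ω (p.1⁻¹ * p.2)) := by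
  have h := f.summable.mul_of_nonneg g.summable (term_nonneg f) (term_nonneg g)
  rw [← (shear G).summable_iff]
  refine h.congr (fun p => ?_)
  simp [shear]

theorem weight_le (ω : Weight G) (x y : G) : ω y ≤ ω x * ω (x⁻¹ * y) := by
  simpa using ω.submul x (x⁻¹ * y)

theorem conv_term_le (f g : BeurlingAlgebra ω) (x y : G) :
    ‖f x * g (x⁻¹ * y)‖ * ω y ≤ (‖f x‖ * ω x) * (‖g (x⁻¹ * y)‖ * ω (x⁻¹ * y)) := by
  rw [norm_mul]
  calc _ ≤ ‖f x‖ * ‖g (x⁻¹ * y)‖ * (ω x * ω (x⁻¹ * y)) :=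
        mul_le_mul_of_nonneg_left (weight_le ω x y) (by positivity)
    _ = _ := by ring

theorem summable_conv_prod (f g : BeurlingAlgebra ω) :
    Summable fun p : G × G => ‖f p.1 * g (p.1⁻¹ * p.2)‖ * ω p.2 :=
  Summable.of_nonneg_of_le (fun _ => mul_nonneg (norm_nonneg _) (ω.pos _).le)
    (fun p => conv_term_le f g p.1 p.2) (summable_prod f g)

theorem summable_conv_norm (f g : BeurlingAlgebra ω) (y : G) :
    Summable fun x => ‖f x * g (x⁻¹ * y)‖ := by
  have h := (summable_conv_prod f g).prod_symm.prod_factor y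
  exact (summable_mul_right_iff (ω.pos y).ne').1 h

theorem summable_conv (f g : BeurlingAlgebra ω) (y : G) :
    Summable fun x => f x * g (x⁻¹ * y) := (summable_conv_norm f g y).of_norm

/-- Convolution of functions on a discrete group. -/
def conv (f g : G → ℂ) (y : G) : ℂ := ∑' x, f x * g (x⁻¹ * y)

theorem norm_conv_le (f g : BeurlingAlgebra ω) (y : G) :
    ‖conv f g y‖ * ω y ≤ ∑' x, ‖f x * g (x⁻¹ * y)‖ * ω y := by
  rw [tsum_mul_right]
  exact mul_le_mul_of_nonneg_right (norm_tsum_le_tsum_norm (summable_conv_norm f g y))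
    (ω.pos y).le

theorem summable_conv_weighted (f g : BeurlingAlgebra ω) :
    Summable fun y => ‖conv f g y‖ * ω y :=
  Summable.of_nonneg_of_le (fun y => mul_nonneg (norm_nonneg _) (ω.pos y).le)
    (norm_conv_le f g) (summable_conv_prod f g).prod_symm.prod

instance : Mul (BeurlingAlgebra ω) := ⟨fun f g => mk (conv f g) (summable_conv_weighted f g)⟩

theorem mul_apply (f g : BeurlingAlgebra ω) (y : G) :
    (f * g) y = ∑' x, f x * g (x⁻¹ * y) := rfl

theorem norm_mul_le' (f g : BeurlingAlgebra ω) : ‖f * g‖ ≤ ‖f‖ * ‖g‖ := by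
  have hp := (summable_conv_prod f g).prod_symm
  calc ‖f * g‖ ≤ ∑' y, ∑' x, ‖f x * g (x⁻¹ * y)‖ * ω y :=
        (f * g).summable.tsum_le_tsum (norm_conv_le f g) hp.prod
    _ = ∑' p : G × G, ‖f p.1 * g (p.1⁻¹ * p.2)‖ * ω p.2 := by
        refine hp.tsum_prod.symm.trans ?_
        exact (Equiv.prodComm G G).tsum_eq
          (fun p : G × G => ‖f p.1 * g (p.1⁻¹ * p.2)‖ * ω p.2)
    _ ≤ ∑' p : G × G, (‖f p.1‖ * ω p.1) * (‖g (p.1⁻¹ * p.2)‖ * ω (p.1⁻¹ * p.2)) :=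
        (summable_conv_prod f g).tsum_le_tsum (fun p => conv_term_le f g p.1 p.2)
          (summable_prod f g)
    _ = ∑' p : G × G, (‖f p.1‖ * ω p.1) * (‖g p.2‖ * ω p.2) := by
        rw [← (shear G).tsum_eq]
        simp [shear]
    _ = ‖f‖ * ‖g‖ := by
        rw [norm_def, norm_def]
        exact (f.summable.tsum_mul_tsum g.summable
          (f.summable.mul_of_nonneg g.summable (term_nonneg f) (term_nonneg g))).symm

theorem mul_assoc' (f g h : BeurlingAlgebra ω) : f * g * h = f * (g * h) := by
  ext z
  have hs : Summable fun p : G × G =>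
      f p.1 * g (p.1⁻¹ * p.2) * h (p.2⁻¹ * z) := by
    refine Summable.of_norm ?_
    rw [← summable_mul_right_iff (ω.pos z).ne']
    refine Summable.of_nonneg_of_le (fun p => mul_nonneg (norm_nonneg _) (ω.pos _).le)
      (fun p => ?_) ((summable_conv_prod f g).mul_right ‖h‖)
    rw [norm_mul]
    calc _ ≤ ‖f p.1 * g (p.1⁻¹ * p.2)‖ * ‖h (p.2⁻¹ * z)‖ * (ω p.2 * ω (p.2⁻¹ * z)) :=
          mul_le_mul_of_nonneg_left (weight_le ω p.2 z) (by positivity)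
      _ = ‖f p.1 * g (p.1⁻¹ * p.2)‖ * ω p.2 * (‖h (p.2⁻¹ * z)‖ * ω (p.2⁻¹ * z)) := by ring
      _ ≤ _ := mul_le_mul_of_nonneg_left (term_le_norm h _)
          (mul_nonneg (norm_nonneg _) (ω.pos _).le)
  calc (f * g * h) z = ∑' y, ∑' x, f x * g (x⁻¹ * y) * h (y⁻¹ * z) := by
        rw [mul_apply]
        exact tsum_congr fun y => by rw [mul_apply, tsum_mul_right]
    _ = ∑' x, ∑' y, f x * g (x⁻¹ * y) * h (y⁻¹ * z) :=
        Summable.tsum_comm (f := fun x y => f x * g (x⁻¹ * y) * h (y⁻¹ * z)) hs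
    _ = (f * (g * h)) z := by
        rw [mul_apply]
        refine tsum_congr fun x => ?_
        rw [mul_apply, ← tsum_mul_left, ← (Equiv.mulLeft x).tsum_eq]
        refine tsum_congr fun y => ?_
        simp [mul_assoc]

theorem left_distrib' (f g h : BeurlingAlgebra ω) : f * (g + h) = f * g + f * h := by
  ext z
  simp only [mul_apply, add_apply, mul_add]
  exact (summable_conv f g z).tsum_add (summable_conv f h z)

theorem right_distrib' (f g h : BeurlingAlgebra ω) : (f + g) * h = f * h + g * h := by
  ext z
  simp only [mul_apply, add_apply, add_mul]
  exact (summable_conv f h z).tsum_add (summable_conv g h z)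

instance : NonUnitalNormedRing (BeurlingAlgebra ω) where
  toNorm := inferInstance
  toMetricSpace := inferInstance
  toNonUnitalRing :=
    { (inferInstance : AddCommGroup (BeurlingAlgebra ω)) with
      mul := (· * ·)
      left_distrib := left_distrib'
      right_distrib := right_distrib'
      zero_mul := fun f => by ext z; simp [mul_apply]
      mul_zero := fun f => by ext z; simp [mul_apply]
      mul_assoc := mul_assoc' }
  dist_eq := NormedAddCommGroup.dist_eq
  norm_mul_le := norm_mul_le'

instance : IsScalarTower ℂ (BeurlingAlgebra ω) (BeurlingAlgebra ω) where
  smul_assoc c f g := by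
    ext z
    simp [mul_apply, mul_assoc, tsum_mul_left]

instance : SMulCommClass ℂ (BeurlingAlgebra ω) (BeurlingAlgebra ω) where
  smul_comm c f g := by
    ext z
    simp [mul_apply, mul_left_comm, tsum_mul_left]

/-- The isometric identification `f ↦ f ω` of `ℓ¹(G, ω)` with `ℓ¹(G)`. -/
def toLpOne (ω : Weight G) : BeurlingAlgebra ω ≃ lp (fun _ : G => ℂ) 1 where
  toFun f := ⟨fun x => f x * (ω x : ℂ), memℓp_gen (by
    simpa [abs_of_pos (ω.pos _)] using f.summable)⟩
  invFun g := mk (fun x => g x * ((ω x : ℂ))⁻¹) (by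
    have h := (lp.memℓp g).summable (by simp)
    refine h.congr fun x => ?_
    have := (ω.pos x).ne'
    simp [abs_of_pos (ω.pos _), this])
  left_inv f := by
    ext x
    have : (ω x : ℂ) ≠ 0 := by exact_mod_cast (ω.pos x).ne'
    simp [this]
  right_inv g := by
    apply lp.ext
    funext x
    have : (ω x : ℂ) ≠ 0 := by exact_mod_cast (ω.pos x).ne'
    simp [this]

theorem isometry_toLpOne (ω : Weight G) : Isometry (toLpOne ω) := by
  refine Isometry.of_dist_eq fun f g => ?_
  rw [dist_eq_norm, dist_eq_norm, lp.norm_eq_tsum_rpow (by simp), norm_def]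
  simp only [ENNReal.toReal_one, Real.rpow_one, div_one]
  refine tsum_congr fun x => ?_
  change ‖f x * (ω x : ℂ) - g x * (ω x : ℂ)‖ = ‖f x - g x‖ * ω x
  rw [← sub_mul, norm_mul, Complex.norm_real, Real.norm_of_nonneg (ω.pos x).le]

instance : CompleteSpace (BeurlingAlgebra ω) :=
  (IsometryEquiv.mk (toLpOne ω) (isometry_toLpOne ω)).completeSpace

end BeurlingAlgebra

/-! ## The `ax + b` group -/

/-- Affine maps `x ↦ a x + b` of the line with `a > 0`. -/
@[ext] structure AxB where
  a : ℝ
  b : ℝ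
  a_pos : 0 < a

namespace AxB

instance : Mul AxB := ⟨fun g h => ⟨g.a * h.a, g.a * h.b + g.b, mul_pos g.a_pos h.a_pos⟩⟩
instance : One AxB := ⟨⟨1, 0, one_pos⟩⟩
instance : Inv AxB := ⟨fun g => ⟨1 / g.a, -g.b / g.a, one_div_pos.2 g.a_pos⟩⟩

@[simp] theorem mul_a (g h : AxB) : (g * h).a = g.a * h.a := rfl
@[simp] theorem mul_b (g h : AxB) : (g * h).b = g.a * h.b + g.b := rfl
@[simp] theorem one_a : (1 : AxB).a = 1 := rfl
@[simp] theorem one_b : (1 : AxB).b = 0 := rfl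
@[simp] theorem inv_a (g : AxB) : (g⁻¹).a = 1 / g.a := rfl
@[simp] theorem inv_b (g : AxB) : (g⁻¹).b = -g.b / g.a := rfl

instance : Group AxB := Group.ofLeftAxioms
  (fun g h k => by ext <;> simp <;> ring)
  (fun g => by ext <;> simp)
  (fun g => by
    have := g.a_pos.ne'
    ext <;> simp <;> field_simp
    try ring)

/-- The subgroup `H_b = {(1, b) : b ∈ ℝ}` of translations. -/
def translations : Subgroup AxB where
  carrier := {g | g.a = 1}
  mul_mem' := by
    intro g h hg hh
    simp_all
  one_mem' := by simp
  inv_mem' := by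
    intro g hg
    simp_all

end AxB

end

/-! A derivation is determined by its values on point masses, where it is a cocycle for conjugation;
it is inner exactly when that cocycle is the coboundary of a function dominated by `ω`.

If `ω` is diagonally bounded, the cocycle `ψ x w` is bounded uniformly in `x` by a multiple of `ω
w`, and its supremum over `x` (real and imaginary parts separately) is the required function. This
works on any discrete group.

Conversely, put `σ t = ω(e^t, 0) ω(e^{-t}, 0)` and `f(1, b) = log σ(log b)` for `b > 0`, `f = 0`
elsewhere. Conjugation by `(a, _)` multiplies `b` by `a`, so it shifts `log b`. As `log σ` is
subadditive and even, `f` changes by at most `log σ(log a)`, which is small enough for `f` to define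
a continuous derivation. If this is inner, `f` differs from some `g` dominated by `ω` by a class
function. All `(1, e^t)` are conjugate and `g` is bounded on translations, so `σ` is bounded; modulo
translations this is diagonal boundedness. -/

noncomputable section

namespace BeurlingAlgebra

variable {G : Type*} [Group G] {ω : Weight G}

/-! ### Point masses and maps determined by them -/

section PointMass

open scoped Classical in
/-- The point mass at `x`. -/
def pointMass (ω : Weight G) (x : G) : BeurlingAlgebra ω :=
  mk (Pi.single x 1) (summable_of_ne_finset_zero (s := {x}) fun y hy => by
    rw [Finset.mem_singleton] at hy
    simp [hy])

theorem pointMass_same (x : G) : pointMass ω x x = 1 := by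
  simp [pointMass]

theorem pointMass_of_ne {x y : G} (h : y ≠ x) : pointMass ω x y = 0 := by
  simp [pointMass, h]

theorem norm_pointMass (x : G) : ‖pointMass ω x‖ = ω x := by
  rw [norm_def, tsum_eq_single x fun y hy => by simp [pointMass_of_ne hy]]
  simp [pointMass_same]

theorem pointMass_mul_pointMass (x y : G) :
    pointMass ω x * pointMass ω y = pointMass ω (x * y) := by
  ext z
  rw [mul_apply, tsum_eq_single x fun u hu => by simp [pointMass_of_ne hu], pointMass_same,
    one_mul]
  by_cases h : z = x * y
  · subst h
    rw [inv_mul_cancel_left, pointMass_same, pointMass_same]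
  · rw [pointMass_of_ne h, pointMass_of_ne fun h' => h (by rw [← h', mul_inv_cancel_left])]

/-- Evaluation at a point is continuous. -/
def evalCLM (ω : Weight G) (x : G) : BeurlingAlgebra ω →L[ℂ] ℂ :=
  LinearMap.mkContinuous
    { toFun := fun f => f x
      map_add' := fun _ _ => rfl
      map_smul' := fun _ _ => rfl } (ω x)⁻¹ fun f => by
    rw [inv_mul_eq_div, le_div_iff₀ (ω.pos x)]
    exact term_le_norm f x

theorem evalCLM_apply (x : G) (f : BeurlingAlgebra ω) : evalCLM ω x f = f x := rfl

theorem hasSum_smul_pointMass (f : BeurlingAlgebra ω) :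
    HasSum (fun x => f x • pointMass ω x) f := by
  have hs : Summable fun x => f x • pointMass ω x := by
    refine Summable.of_norm (f.summable.congr fun x => ?_)
    rw [norm_smul, norm_pointMass]
  have key : ∑' x, f x • pointMass ω x = f := by
    ext y
    rw [← evalCLM_apply, (evalCLM ω y).map_tsum hs,
      tsum_eq_single y fun x hx => by simp [evalCLM_apply, pointMass_of_ne hx.symm]]
    simp [evalCLM_apply, pointMass_same]
  simpa only [key] using hs.hasSum

variable {E : Type*} [NormedAddCommGroup E] [NormedSpace ℂ E]

theorem clm_ext {S T : BeurlingAlgebra ω →L[ℂ] E}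
    (h : ∀ x, S (pointMass ω x) = T (pointMass ω x)) : S = T := by
  ext f
  have hS := (hasSum_smul_pointMass f).mapL S
  have hT := (hasSum_smul_pointMass f).mapL T
  simp only [map_smul, h] at hS hT
  exact hS.unique hT

theorem summable_smul_of_le {φ : G → E} {C : ℝ} (hφ : ∀ x, ‖φ x‖ ≤ C * ω x)
    (f : BeurlingAlgebra ω) : Summable fun x => ‖f x • φ x‖ := by
  refine Summable.of_nonneg_of_le (fun x => norm_nonneg _) (fun x => ?_) (f.summable.mul_left C)
  rw [norm_smul]
  exact (mul_le_mul_of_nonneg_left (hφ x) (norm_nonneg _)).trans_eq (by ring)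

variable [CompleteSpace E]

/-- The continuous linear map on `ℓ¹(G, ω)` with prescribed values on point masses. -/
def lift (φ : G → E) (C : ℝ) (hφ : ∀ x, ‖φ x‖ ≤ C * ω x) : BeurlingAlgebra ω →L[ℂ] E :=
  LinearMap.mkContinuous
    { toFun := fun f => ∑' x, f x • φ x
      map_add' := fun f g => by
        simp only [add_apply, add_smul]
        exact (summable_smul_of_le hφ f).of_norm.tsum_add (summable_smul_of_le hφ g).of_norm
      map_smul' := fun c f => by
        simp only [smul_apply, mul_smul, RingHom.id_apply]
        exact (summable_smul_of_le hφ f).of_norm.tsum_const_smul c } C fun f => by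
    rw [norm_def, ← tsum_mul_left]
    refine (norm_tsum_le_tsum_norm (summable_smul_of_le hφ f)).trans
      ((summable_smul_of_le hφ f).tsum_le_tsum (fun x => ?_) (f.summable.mul_left C))
    rw [norm_smul]
    exact (mul_le_mul_of_nonneg_left (hφ x) (norm_nonneg _)).trans_eq (by ring)

theorem lift_pointMass (φ : G → E) (C : ℝ) (hφ : ∀ x, ‖φ x‖ ≤ C * ω x) (x : G) :
    lift φ C hφ (pointMass ω x) = φ x := by
  change ∑' y, pointMass ω x y • φ y = φ x
  rw [tsum_eq_single x fun y hy => by simp [pointMass_of_ne hy], pointMass_same, one_smul]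

theorem norm_lift_le (φ : G → E) {C : ℝ} (hC : 0 ≤ C) (hφ : ∀ x, ‖φ x‖ ≤ C * ω x) :
    ‖lift φ C hφ‖ ≤ C :=
  LinearMap.mkContinuous_norm_le _ hC _

end PointMass

/-! ### Derivations as conjugation cocycles -/

section Derivations

/-- Both sides are continuous and linear in each of the three arguments, so `clm_ext` frees them one
at a time. -/
theorem isDualDerivation_of_pointMass
    {D : BeurlingAlgebra ω →L[ℂ] StrongDual ℂ (BeurlingAlgebra ω)}
    (h : ∀ x y z, D (pointMass ω (x * y)) (pointMass ω z) =
      D (pointMass ω y) (pointMass ω (z * x)) + D (pointMass ω x) (pointMass ω (y * z))) :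
    IsDualDerivation D := by
  let m := ContinuousLinearMap.mul ℂ (BeurlingAlgebra ω)
  have h₁ : ∀ x y c, D (pointMass ω x * pointMass ω y) c =
      D (pointMass ω y) (c * pointMass ω x) + D (pointMass ω x) (pointMass ω y * c) := by
    intro x y c
    refine DFunLike.congr_fun (f := D (pointMass ω x * pointMass ω y))
      (g := (D (pointMass ω y)).comp (m.flip (pointMass ω x)) +
        (D (pointMass ω x)).comp (m (pointMass ω y))) (clm_ext fun z => ?_) c
    simpa [m, pointMass_mul_pointMass] using h x y z
  have h₂ : ∀ x b c, D (pointMass ω x * b) c =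
      D b (c * pointMass ω x) + D (pointMass ω x) (b * c) := by
    intro x b c
    refine DFunLike.congr_fun
      (f := (ContinuousLinearMap.apply ℂ ℂ c).comp (D.comp (m (pointMass ω x))))
      (g := (ContinuousLinearMap.apply ℂ ℂ (c * pointMass ω x)).comp D +
        (D (pointMass ω x)).comp (m.flip c)) (clm_ext fun y => ?_) b
    simpa [m] using h₁ x y c
  intro a b
  ext c
  refine DFunLike.congr_fun
    (f := (ContinuousLinearMap.apply ℂ ℂ c).comp (D.comp (m.flip b)))
    (g := (D b).comp (m c) + (ContinuousLinearMap.apply ℂ ℂ (b * c)).comp D)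
    (clm_ext fun x => ?_) a
  simpa [m] using h₂ x b c

theorem isInnerDualDerivation_of_pointMass
    {D : BeurlingAlgebra ω →L[ℂ] StrongDual ℂ (BeurlingAlgebra ω)}
    (F : StrongDual ℂ (BeurlingAlgebra ω))
    (h : ∀ x z, D (pointMass ω x) (pointMass ω z) =
      F (pointMass ω (z * x)) - F (pointMass ω (x * z))) :
    IsInnerDualDerivation D := by
  let m := ContinuousLinearMap.mul ℂ (BeurlingAlgebra ω)
  have h₁ : ∀ x c, D (pointMass ω x) c = F (c * pointMass ω x) - F (pointMass ω x * c) := by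
    intro x c
    refine DFunLike.congr_fun (f := D (pointMass ω x))
      (g := F.comp (m.flip (pointMass ω x)) - F.comp (m (pointMass ω x)))
      (clm_ext fun z => ?_) c
    simpa [m, pointMass_mul_pointMass] using h x z
  refine ⟨F, fun a => ?_⟩
  ext c
  refine DFunLike.congr_fun (f := (ContinuousLinearMap.apply ℂ ℂ c).comp D)
    (g := F.comp (m c) - F.comp (m.flip c)) (clm_ext fun x => ?_) a
  simpa [m] using h₁ x c

/-- A uniformly bounded real cocycle for the conjugation action is the coboundary of its
pointwise supremum. -/
theorem iSup_cocycle {ψ : G → G → ℝ} (hψ : ∀ w, BddAbove (Set.range fun x => ψ x w))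
    (hc : ∀ x y w, ψ (x * y) w = ψ y w + ψ x (y * w * y⁻¹)) (y w : G) :
    ⨆ x, ψ x w = ψ y w + ⨆ x, ψ x (y * w * y⁻¹) := by
  -- The supremum is unchanged by `x ↦ x * y`, after which the cocycle identity applies termwise.
  rw [← (Equiv.mulRight y).iSup_comp (g := fun x => ψ x w), add_ciSup (hψ _)]
  exact iSup_congr fun x => hc x y w

theorem abs_iSup_le {ι : Type*} [Nonempty ι] {u : ι → ℝ} {B : ℝ} (h : ∀ i, |u i| ≤ B) :
    |⨆ i, u i| ≤ B := by
  have hb : BddAbove (Set.range u) := ⟨B, by rintro _ ⟨i, rfl⟩; exact (abs_le.1 (h i)).2⟩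
  obtain ⟨i⟩ := ‹Nonempty ι›
  exact abs_le.2 ⟨(abs_le.1 (h i)).1.trans (le_ciSup hb i), ciSup_le fun j => (abs_le.1 (h j)).2⟩

theorem weaklyAmenable_of_diagonallyBounded (h : ω.DiagonallyBounded) :
    WeaklyAmenable (BeurlingAlgebra ω) := by
  obtain ⟨C, hC⟩ := h
  intro D hD
  -- For `D` inner via `F`, this would be `F` at `w` minus `F` at `x * w * x⁻¹`.
  let ψ : G → G → ℂ := fun x w => D (pointMass ω x) (pointMass ω (w * x⁻¹))
  have hψ : ∀ x w, ‖ψ x w‖ ≤ ‖D‖ * C * ω w := fun x w => by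
    have hD' := (D (pointMass ω x)).le_of_opNorm_le (D.le_opNorm _) (pointMass ω (w * x⁻¹))
    rw [norm_pointMass, norm_pointMass, mul_assoc] at hD'
    rw [mul_assoc]
    refine hD'.trans (mul_le_mul_of_nonneg_left ?_ (norm_nonneg D))
    calc ω x * ω (w * x⁻¹) ≤ ω x * (ω w * ω x⁻¹) :=
          mul_le_mul_of_nonneg_left (ω.submul _ _) (ω.pos x).le
      _ = ω x * ω x⁻¹ * ω w := by ring
      _ ≤ C * ω w := mul_le_mul_of_nonneg_right (hC x) (ω.pos w).le
  have hc : ∀ x y w, ψ (x * y) w = ψ y w + ψ x (y * w * y⁻¹) := fun x y w => by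
    have := DFunLike.congr_fun (hD (pointMass ω x) (pointMass ω y))
      (pointMass ω (w * (x * y)⁻¹))
    simpa [ψ, dualLeftAction, dualRightAction, pointMass_mul_pointMass, mul_assoc] using this
  have hre : ∀ w x, |(ψ x w).re| ≤ ‖D‖ * C * ω w :=
    fun w x => (Complex.abs_re_le_norm _).trans (hψ x w)
  have him : ∀ w x, |(ψ x w).im| ≤ ‖D‖ * C * ω w :=
    fun w x => (Complex.abs_im_le_norm _).trans (hψ x w)
  let f : G → ℂ := fun w => ⟨⨆ x, (ψ x w).re, ⨆ x, (ψ x w).im⟩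
  have hf : ∀ w, ‖f w‖ ≤ 2 * (‖D‖ * C) * ω w := fun w =>
    (Complex.norm_le_abs_re_add_abs_im _).trans <|
      (add_le_add (abs_iSup_le (hre w)) (abs_iSup_le (him w))).trans_eq (by ring)
  have hcob : ∀ y w, f w = ψ y w + f (y * w * y⁻¹) := fun y w =>
    Complex.ext
      (iSup_cocycle (ψ := fun x w => (ψ x w).re)
        (fun w => ⟨_, by rintro _ ⟨x, rfl⟩; exact (abs_le.1 (hre w x)).2⟩)
        (fun x y w => by simp only [hc x y w, Complex.add_re]) y w)
      (iSup_cocycle (ψ := fun x w => (ψ x w).im)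
        (fun w => ⟨_, by rintro _ ⟨x, rfl⟩; exact (abs_le.1 (him w x)).2⟩)
        (fun x y w => by simp only [hc x y w, Complex.add_im]) y w)
  refine isInnerDualDerivation_of_pointMass (lift f _ hf) fun x z => ?_
  rw [lift_pointMass, lift_pointMass, hcob x (z * x)]
  simp [ψ, mul_assoc]

/-- If `f (z x) - f (x z)` is dominated by `ω x * ω z` and `ℓ¹(G, ω)` is weakly amenable, then
`f` differs from a function dominated by `ω` by a function that is constant on conjugacy
classes. -/
theorem exists_dominated_of_weaklyAmenable (hA : WeaklyAmenable (BeurlingAlgebra ω)) {f : G → ℂ}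
    {C : ℝ} (hC : 0 ≤ C) (hf : ∀ x z, ‖f (z * x) - f (x * z)‖ ≤ C * ω x * ω z) :
    ∃ (g : G → ℂ) (B : ℝ), (∀ x, ‖g x‖ ≤ B * ω x) ∧
      ∀ x z, f (z * x) - f (x * z) = g (z * x) - g (x * z) := by
  let D : BeurlingAlgebra ω →L[ℂ] StrongDual ℂ (BeurlingAlgebra ω) :=
    lift (fun x => lift (fun z => f (z * x) - f (x * z)) (C * ω x) (hf x)) C
      fun x => norm_lift_le _ (mul_nonneg hC (ω.pos x).le) _
  have hDv : ∀ x z, D (pointMass ω x) (pointMass ω z) = f (z * x) - f (x * z) := fun x z => by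
    simp only [D, lift_pointMass]
  -- The identity telescopes through the cyclic word `y * z * x`.
  obtain ⟨F, hF⟩ := hA D <| isDualDerivation_of_pointMass fun x y z => by
    simp only [hDv, mul_assoc]
    ring
  refine ⟨fun x => F (pointMass ω x), ‖F‖, fun x => ?_, fun x z => ?_⟩
  · rw [← norm_pointMass (ω := ω)]
    exact F.le_opNorm _
  · rw [← hDv, hF]
    simp [dualLeftAction, dualRightAction, pointMass_mul_pointMass]

end Derivations

end BeurlingAlgebra

/-! ### The symmetrized weight on dilations -/

namespace AxB

/-- The dilation by `exp t`. -/
def dilation (t : ℝ) : AxB := ⟨Real.exp t, 0, Real.exp_pos t⟩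

theorem dilation_add (s t : ℝ) : dilation (s + t) = dilation s * dilation t := by
  ext <;> simp [dilation, Real.exp_add]

/-- Translation by `b`. -/
def translation (b : ℝ) : AxB := ⟨1, b, one_pos⟩

theorem translation_mem (b : ℝ) : translation b ∈ (translations : Set AxB) := rfl

theorem eq_translation_mul_dilation (g : AxB) :
    g = translation g.b * dilation (Real.log g.a) := by
  ext <;> simp [dilation, translation, Real.exp_log g.a_pos]

theorem dilation_eq_translation_mul (g : AxB) :
    dilation (Real.log g.a) = translation (-g.b) * g := by
  ext <;> simp [dilation, translation, Real.exp_log g.a_pos]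

variable (ω : Weight AxB)

/-- The symmetrization `t ↦ ω(e^t, 0) ω(e^{-t}, 0)`. -/
def symmWeight (t : ℝ) : ℝ := ω (dilation t) * ω (dilation (-t))

theorem symmWeight_pos (t : ℝ) : 0 < symmWeight ω t := mul_pos (ω.pos _) (ω.pos _)

theorem symmWeight_neg (t : ℝ) : symmWeight ω (-t) = symmWeight ω t := by
  rw [symmWeight, symmWeight, neg_neg, mul_comm]

theorem symmWeight_add_le (s t : ℝ) :
    symmWeight ω (s + t) ≤ symmWeight ω s * symmWeight ω t := by
  have h₁ : ω (dilation (s + t)) ≤ ω (dilation s) * ω (dilation t) := by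
    rw [dilation_add]
    exact ω.submul _ _
  have h₂ : ω (dilation (-(s + t))) ≤ ω (dilation (-s)) * ω (dilation (-t)) := by
    rw [neg_add, dilation_add]
    exact ω.submul _ _
  calc symmWeight ω (s + t) ≤ _ :=
        mul_le_mul h₁ h₂ (ω.pos _).le (mul_nonneg (ω.pos _).le (ω.pos _).le)
    _ = _ := by simp only [symmWeight]; ring

/-- Subadditivity of `log σ` is used for `s, t` and for `s + t, -t`; evenness makes the two bounds
agree. Finally `log σ ≤ σ`, because `σ` is what compares with `ω x * ω z`. -/
theorem abs_log_symmWeight_sub_le (s t : ℝ) :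
    |Real.log (symmWeight ω s) - Real.log (symmWeight ω (s + t))| ≤ symmWeight ω t := by
  have key : ∀ u r, Real.log (symmWeight ω (u + r)) ≤
      Real.log (symmWeight ω u) + Real.log (symmWeight ω r) := fun u r => by
    rw [← Real.log_mul (symmWeight_pos ω u).ne' (symmWeight_pos ω r).ne']
    exact Real.log_le_log (symmWeight_pos ω _) (symmWeight_add_le ω u r)
  have h₁ := key s t
  have h₂ := key (s + t) (-t)
  rw [add_neg_cancel_right, symmWeight_neg] at h₂
  have h₃ := Real.log_le_self (symmWeight_pos ω t).le
  exact abs_le.2 ⟨by linarith, by linarith⟩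

variable {ω}

/-- Here `x` and `z` have opposite dilation parameters, and removing each translation part costs a
factor `K`. -/
theorem symmWeight_log_le {K : ℝ} (hK : ∀ g ∈ (translations : Set AxB), ω g ≤ K) {x z : AxB}
    (h : (z * x).a = 1) : symmWeight ω (Real.log x.a) ≤ K * K * ω x * ω z := by
  have hd : ∀ g : AxB, ω (dilation (Real.log g.a)) ≤ K * ω g := fun g => by
    rw [dilation_eq_translation_mul]
    exact (ω.submul _ _).trans
      (mul_le_mul_of_nonneg_right (hK _ (translation_mem _)) (ω.pos g).le)
  have hz : -Real.log x.a = Real.log z.a := by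
    have := Real.log_mul z.a_pos.ne' x.a_pos.ne'
    rw [← mul_a, h, Real.log_one] at this
    linarith
  rw [symmWeight, hz]
  calc _ ≤ K * ω x * (K * ω z) :=
        mul_le_mul (hd x) (hd z) (ω.pos _).le ((ω.pos _).le.trans (hd x))
    _ = _ := by ring

theorem diagonallyBounded_of_symmWeight_le {K B : ℝ}
    (hK : ∀ g ∈ (translations : Set AxB), ω g ≤ K) (hB : ∀ t, symmWeight ω t ≤ B) :
    ω.DiagonallyBounded := by
  refine ⟨K * K * B, fun x => ?_⟩
  have hK0 : 0 ≤ K := (ω.pos _).le.trans (hK _ (translation_mem 0))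
  have hd : ∀ g : AxB, ω g ≤ K * ω (dilation (Real.log g.a)) := fun g => by
    conv_lhs => rw [eq_translation_mul_dilation g]
    exact (ω.submul _ _).trans
      (mul_le_mul_of_nonneg_right (hK _ (translation_mem _)) (ω.pos _).le)
  have hi : Real.log (x⁻¹).a = -Real.log x.a := by rw [inv_a, one_div, Real.log_inv]
  have hdi := hd x⁻¹
  rw [hi] at hdi
  calc ω x * ω x⁻¹ ≤ _ :=
        mul_le_mul (hd x) hdi (ω.pos _).le ((ω.pos _).le.trans (hd x))
    _ = K * K * symmWeight ω (Real.log x.a) := by rw [symmWeight]; ring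
    _ ≤ _ := mul_le_mul_of_nonneg_left (hB _) (mul_nonneg hK0 hK0)

/-! ### The test function on translations -/

variable (ω) in
open scoped Classical in
/-- The function `(1, b) ↦ log (symmWeight ω (log b))` for `b > 0`, extended by zero. -/
def logSymmWeight (g : AxB) : ℝ :=
  if g.a = 1 ∧ 0 < g.b then Real.log (symmWeight ω (Real.log g.b)) else 0

theorem abs_logSymmWeight_sub_le {K : ℝ} (hK : ∀ g ∈ (translations : Set AxB), ω g ≤ K)
    (x z : AxB) :
    |logSymmWeight ω (z * x) - logSymmWeight ω (x * z)| ≤ K * K * ω x * ω z := by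
  -- `x * z` is the conjugate of `z * x` by `x`.
  have hb : (z * x).a = 1 → (x * z).b = x.a * (z * x).b := fun h => by
    simp only [mul_a, mul_b] at h ⊢
    linear_combination -x.b * h
  have ha : (x * z).a = (z * x).a := mul_comm _ _
  by_cases h : (z * x).a = 1 ∧ 0 < (z * x).b
  · have h' : (x * z).a = 1 ∧ 0 < (x * z).b :=
      ⟨ha.trans h.1, by rw [hb h.1]; exact mul_pos x.a_pos h.2⟩
    rw [logSymmWeight, logSymmWeight, if_pos h, if_pos h', hb h.1,
      Real.log_mul x.a_pos.ne' h.2.ne', add_comm (Real.log x.a)]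
    exact (abs_log_symmWeight_sub_le ω _ _).trans (symmWeight_log_le hK h.1)
  -- Conjugation preserves the support of the test function, so both values vanish.
  · have h' : ¬((x * z).a = 1 ∧ 0 < (x * z).b) := fun h' => h
      ⟨ha.symm.trans h'.1, pos_of_mul_pos_right (hb (ha.symm.trans h'.1) ▸ h'.2) x.a_pos.le⟩
    rw [logSymmWeight, logSymmWeight, if_neg h, if_neg h', sub_zero, abs_zero]
    exact mul_nonneg (mul_nonneg (mul_self_nonneg K) (ω.pos x).le) (ω.pos z).le

theorem logSymmWeight_translation_exp (t : ℝ) :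
    logSymmWeight ω (translation (Real.exp t)) = Real.log (symmWeight ω t) := by
  rw [logSymmWeight, if_pos ⟨rfl, Real.exp_pos t⟩]
  simp only [translation, Real.log_exp]

theorem dilation_mul_translation_mul (t : ℝ) :
    dilation t * (translation 1 * dilation (-t)) = translation (Real.exp t) := by
  ext <;> simp [dilation, translation, ← Real.exp_add]

theorem translation_mul_dilation_mul (t : ℝ) :
    translation 1 * dilation (-t) * dilation t = translation 1 := by
  ext <;> simp [dilation, translation, ← Real.exp_add]

theorem diagonallyBounded_of_weaklyAmenable (hb : ω.BoundedOn (translations : Set AxB))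
    (hA : WeaklyAmenable (BeurlingAlgebra ω)) : ω.DiagonallyBounded := by
  obtain ⟨K, hK⟩ := hb
  obtain ⟨g, B, hg, hfg⟩ := BeurlingAlgebra.exists_dominated_of_weaklyAmenable hA
    (f := fun x => (logSymmWeight ω x : ℂ)) (mul_self_nonneg K) fun x z => by
      rw [← Complex.ofReal_sub, Complex.norm_real]
      exact abs_logSymmWeight_sub_le hK x z
  have hB : 0 ≤ B := nonneg_of_mul_nonneg_left ((norm_nonneg _).trans (hg 1)) (ω.pos 1)
  have hgK : ∀ b, ‖g (translation b)‖ ≤ B * K := fun b =>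
    (hg _).trans (mul_le_mul_of_nonneg_left (hK _ (translation_mem b)) hB)
  refine diagonallyBounded_of_symmWeight_le (B := Real.exp
    (‖(logSymmWeight ω (translation 1) : ℂ)‖ + (B * K + B * K))) hK fun t => ?_
  -- The two products are the conjugate elements `(1, 1)` and `(1, e^t)`.
  have ht := hfg (dilation t) (translation 1 * dilation (-t))
  rw [dilation_mul_translation_mul, translation_mul_dilation_mul] at ht
  rw [← Real.log_le_iff_le_exp (symmWeight_pos ω t), ← logSymmWeight_translation_exp]
  calc logSymmWeight ω (translation (Real.exp t))
      ≤ ‖(logSymmWeight ω (translation (Real.exp t)) : ℂ)‖ := by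
        rw [Complex.norm_real]
        exact le_abs_self _
    _ = ‖(logSymmWeight ω (translation 1) : ℂ) -
          (g (translation 1) - g (translation (Real.exp t)))‖ := by
        rw [← ht, sub_sub_cancel]
    _ ≤ _ := (norm_sub_le _ _).trans (add_le_add_right
        ((norm_sub_le _ _).trans (add_le_add (hgK _) (hgK _))) _)

end AxB

end

theorem mainTheorem7 (ω : Weight AxB) (h_away : ω.BoundedAwayFromZero)
    (h_bdd : ω.BoundedOn (AxB.translations : Set AxB)) :
    WeaklyAmenable (BeurlingAlgebra ω) ↔ ω.DiagonallyBounded :=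
  ⟨AxB.diagonallyBounded_of_weaklyAmenable h_bdd,
    BeurlingAlgebra.weaklyAmenable_of_diagonallyBounded⟩
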